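/- Let $G$ be a finite group and $p$ an odd prime dividing $|G|$. Let $\mathcal{N}_p(G)=G\setminus\{x^p : x\in G\}$ be the set of elements of $G$ that are not $p$-th powers, and let $n=|\mathcal{N}_p(G)|$. The set $\mathcal{N}_p(G)$ is a union of conjugacy classes of $G$; its \emph{length} is the number of these classes, and its \emph{type} is the list of the orders of representatives of these classes (one entry for each class), written in nondecreasing order. A \emph{Frobenius group} is a finite group with a nontrivial normal subgroup $K$ that has a nontrivial complement $H$ such that no nonidentity element of $H$ commutes with a nonidentity element of $K$. Suppose that $\mathcal{N}_p(G)$ has length $2$ and that $|G|>\frac{n^2}{2}$. Then one of the following holds: (1) the type of $\mathcal{N}_p(G)$ is $(p,p)$, $|G|=\frac{n}{2}(n+1)$, and $G$ is a Frobenius group unless $|G|=3$; (2) the type of $\mathcal{N}_p(G)$ is $(p,2p)$, $|G|=\frac{n}{2}(n+2)$, and $G$ is a central extension of a Frobenius group $F$ of order $\frac{n}{2}\left(\frac{n}{2}+1\right)$, that is, there is a surjective homomorphism $G\to F$ whose kernel is contained in the center of $G$. -/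

import Mathlib

universe u

namespace NonPowers

/-- The set `N_k(G) = G \ G^k` of elements of `G` that are not `k`-th powers. -/
def nonPowers (G : Type*) [Group G] (k : ℕ) : Set G :=
  {x | ∃ y : G, y ^ k = x}ᶜ

/-- The number `n_k(G) = |N_k(G)|` of non-`k`-th powers. -/
noncomputable def numNonPowers (G : Type*) [Group G] (k : ℕ) : ℕ :=
  (nonPowers G k).ncard

/-- The conjugacy classes of `G` contained in `N_k(G)`. -/
def nonPowerClasses (G : Type*) [Group G] (k : ℕ) : Set (ConjClasses G) :=
  {c | c.carrier ⊆ nonPowers G k}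

theorem orderOf_eq_of_isConj {G : Type*} [Group G] {x y : G} (h : IsConj x y) :
    orderOf x = orderOf y := by
  obtain ⟨c, rfl⟩ := isConj_iff.1 h
  exact (MulEquiv.orderOf_eq (MulAut.conj c) x).symm

/-- The common order of the elements of a conjugacy class. -/
noncomputable def classOrder {G : Type*} [Group G] (c : ConjClasses G) : ℕ :=
  Quotient.lift (s := IsConj.setoid G) (fun x : G => orderOf x)
    (fun _ _ h => orderOf_eq_of_isConj h) c

/-- The length of `N_k(G)`: the number of conjugacy classes of which it is the union. -/
noncomputable def length (G : Type*) [Group G] (k : ℕ) : ℕ :=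
  (nonPowerClasses G k).ncard

/-- The type of `N_k(G)`: the list of the element orders of the conjugacy classes contained in
`N_k(G)`, one entry per class, in nondecreasing order. -/
noncomputable def type (G : Type*) [Group G] [Finite G] (k : ℕ) : List ℕ :=
  (((nonPowerClasses G k).toFinite.toFinset.val).map classOrder).sort (· ≤ ·)

/-- A finite group is a Frobenius group if it has a nontrivial normal subgroup `K` (the kernel)
with a nontrivial complement `H` such that no nonidentity element of `H` centralizes a
nonidentity element of `K`. -/
def IsFrobeniusGroup (G : Type*) [Group G] : Prop :=
  Finite G ∧ ∃ K H : Subgroup G, K.Normal ∧ K ≠ ⊥ ∧ H ≠ ⊥ ∧ K.IsComplement' H ∧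
    ∀ h ∈ H, h ≠ 1 → ∀ k ∈ K, k ≠ 1 → h * k * h⁻¹ ≠ k

/-- `E` is a central extension of `F`: there is a surjective homomorphism `E → F` whose kernel
is contained in the center of `E`. -/
def IsCentralExtension (E F : Type*) [Group E] [Group F] : Prop :=
  ∃ f : E →* F, Function.Surjective f ∧ f.ker ≤ Subgroup.center E

end NonPowers

/-! Let q be the p-part of |G|. Multiplying a p-th root by commuting elements of order p gives p
roots, so at most a proportion 1/p of the p-elements are p-th powers, and at least (1 - 1/p)q of
them are non-powers. If some non-power is not a p-element, the non-powers of that kind also number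
at least (1 - 1/p)q (`ordProj_mul_le_of_not_isPElement`). On the other hand, if u is a p'-element
centralizing a non-power p-element x, then xu is a non-power, so having only two classes leaves
little room in C(x). Combined with n² < 2|G|, this makes q divide the centralizer orders of the
non-power p-elements and leaves fewer than q such elements.

Two Sylow p-subgroups would then produce too many p-elements, so the Sylow subgroup P is normal; it
is elementary abelian, and its nonidentity elements are exactly the non-power p-elements
(`exists_normal_elementary_sylow`).

If all non-powers are p-elements, centralizers of nonidentity elements of P equal P, and G is
Frobenius with kernel P or G = P has order 3. Otherwise C(x) contains exactly one nonidentity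
p'-element u (`centralizer_structure`); it is a central involution, and G/⟨u⟩ is Frobenius with
kernel the image of P. -/

namespace NonPowers

/-- An element of a group is a `p`-element if its order is a power of `p`. -/
def IsPElement {G : Type*} [Group G] (p : ℕ) (g : G) : Prop :=
  ∃ k : ℕ, g ^ p ^ k = 1

/-! ### Conjugacy, p-parts and p'-parts. -/

section Basic

variable {G : Type*} [Group G] {p : ℕ}

theorem mem_nonPowers {k : ℕ} {x : G} : x ∈ nonPowers G k ↔ ∀ y : G, y ^ k ≠ x := by
  simp [nonPowers]

theorem conj_mem_nonPowers {k : ℕ} {x y : G} (h : IsConj x y) (hx : x ∈ nonPowers G k) :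
    y ∈ nonPowers G k := by
  obtain ⟨c, rfl⟩ := isConj_iff.1 h
  rw [mem_nonPowers] at hx ⊢
  intro z hz
  refine hx (c⁻¹ * z * c) ?_
  have := conj_pow (i := k) (a := c⁻¹) (b := z)
  rw [inv_inv] at this
  rw [this, hz]
  group

theorem isPElement_pow_iff {g : G} : IsPElement p (g ^ p) ↔ IsPElement p g := by
  constructor
  · rintro ⟨k, hk⟩
    exact ⟨k + 1, by rw [pow_succ', pow_mul, hk]⟩
  · rintro ⟨k, hk⟩
    exact ⟨k, by rw [← pow_mul, mul_comm, pow_mul, hk, one_pow]⟩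

theorem IsPElement.isConj {x y : G} (hx : IsPElement p x) (h : IsConj x y) : IsPElement p y := by
  obtain ⟨c, rfl⟩ := isConj_iff.1 h
  obtain ⟨k, hk⟩ := hx
  exact ⟨k, by rw [conj_pow, hk]; group⟩

theorem ncard_conj_mul_card_centralizer [Finite G] (x : G) :
    {y | IsConj x y}.ncard * Nat.card (Subgroup.centralizer {x}) = Nat.card G := by
  rw [Subgroup.nat_card_centralizer_nat_card_stabilizer]
  have := (MulAction.stabilizer (ConjAct G) x).index_mul_card
  rw [MulAction.index_stabilizer] at this
  rw [← Nat.card_congr (ConjAct.ofConjAct (G := G)).toEquiv, ← this]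
  congr 2
  ext y
  rw [ConjAct.mem_orbit_conjAct, isConj_comm]
  rfl

theorem card_centralizer_eq_of_isConj [Finite G] {x y : G} (h : IsConj x y) :
    Nat.card (Subgroup.centralizer {x}) = Nat.card (Subgroup.centralizer {y}) := by
  have hx := ncard_conj_mul_card_centralizer x
  have hy := ncard_conj_mul_card_centralizer y
  have e : {z | IsConj x z} = {z | IsConj y z} :=
    Set.ext fun z => ⟨fun hz => h.symm.trans hz, fun hz => h.trans hz⟩
  rw [e, ← hy] at hx
  refine Nat.eq_of_mul_eq_mul_left ?_ hx
  rw [Set.ncard_pos]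
  exact ⟨y, IsConj.refl y⟩

/-- Projection exponents: `N` projects every element to its `p'`-part and `M` to its `p`-part. -/
theorem exists_part_exponents (G : Type*) [Group G] [Finite G] (p : ℕ) [hp : Fact p.Prime] :
    ∃ N M : ℕ, (∀ g : G, g ^ N * g ^ M = g) ∧ (∀ g : G, ¬ p ∣ orderOf (g ^ N)) ∧
      (∀ g : G, IsPElement p (g ^ M)) ∧
      (∀ g : G, IsPElement p g → g ^ N = 1 ∧ g ^ M = g) ∧
      (∀ g : G, ¬ p ∣ orderOf g → g ^ N = g ∧ g ^ M = 1) := by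
  set q := ordProj[p] (Nat.card G) with hq
  set t := ordCompl[p] (Nat.card G) with ht
  have hqt : q * t = Nat.card G := Nat.ordProj_mul_ordCompl_eq_self _ _
  have hpt : ¬ p ∣ t := Nat.not_dvd_ordCompl hp.out Nat.card_pos.ne'
  have hcop : Nat.Coprime q t := Nat.Coprime.pow_left _ ((Nat.Prime.coprime_iff_not_dvd hp.out).2 hpt)
  -- These are the idempotents of ℤ/q × ℤ/t. Since they do not depend on g, taking parts is
  -- compatible with conjugation and with products of commuting elements.
  obtain ⟨N, hN0, hN1⟩ := Nat.chineseRemainder hcop 0 1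
  obtain ⟨M, hM1, hM0⟩ := Nat.chineseRemainder hcop 1 0
  have hqN : q ∣ N := (Nat.modEq_zero_iff_dvd).1 hN0
  have htM : t ∣ M := (Nat.modEq_zero_iff_dvd).1 hM0
  have hsum : N + M ≡ 1 [MOD Nat.card G] := by
    rw [← hqt, ← Nat.modEq_and_modEq_iff_modEq_mul hcop]
    exact ⟨by simpa using hN0.add hM1, by simpa using hN1.add hM0⟩
  have hord (g : G) : orderOf g ∣ q * t := hqt ▸ orderOf_dvd_natCard g
  have hone {a : ℕ} {g : G} (h : a ≡ 1 [MOD orderOf g]) : g ^ a = g := by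
    simpa using pow_eq_pow_iff_modEq.2 h
  have hpq {g : G} (h : IsPElement p g) : orderOf g ∣ q := by
    obtain ⟨k, hk⟩ := h
    refine Nat.Coprime.dvd_of_dvd_mul_right ?_ (hord g)
    refine Nat.Coprime.of_dvd_left (orderOf_dvd_of_pow_eq_one hk) ?_
    exact Nat.Coprime.pow_left _ ((Nat.Prime.coprime_iff_not_dvd hp.out).2 hpt)
  have hpt' {g : G} (h : ¬ p ∣ orderOf g) : orderOf g ∣ t := by
    refine Nat.Coprime.dvd_of_dvd_mul_left ?_ (hord g)
    exact (Nat.Coprime.pow_left _ ((Nat.Prime.coprime_iff_not_dvd hp.out).2 h)).symm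
  refine ⟨N, M, fun g => ?_, fun g h => hpt (h.trans ?_), fun g => ⟨(Nat.card G).factorization p, ?_⟩,
    fun g h => ⟨?_, ?_⟩,
    fun g h => ⟨?_, ?_⟩⟩
  · rw [← pow_add]
    exact hone (hsum.of_dvd (orderOf_dvd_natCard g))
  · refine orderOf_dvd_of_pow_eq_one ?_
    rw [← pow_mul]
    exact orderOf_dvd_iff_pow_eq_one.1 ((hord g).trans (mul_dvd_mul_right hqN t))
  · rw [← hq, ← pow_mul, mul_comm]
    exact orderOf_dvd_iff_pow_eq_one.1 ((hord g).trans (mul_dvd_mul_left q htM))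
  · exact orderOf_dvd_iff_pow_eq_one.1 ((hpq h).trans hqN)
  · exact hone (hM1.of_dvd (hpq h))
  · exact hone (hN1.of_dvd (hpt' h))
  · exact orderOf_dvd_iff_pow_eq_one.1 ((hpt' h).trans htM)

theorem dvd_orderOf_of_mem_nonPowers [hp : Fact p.Prime] {x : G} (hx : x ∈ nonPowers G p) :
    p ∣ orderOf x := by
  by_contra h
  obtain ⟨m, hm⟩ := exists_pow_eq_self_of_coprime (n := p) (x := x)
    ((Nat.Prime.coprime_iff_not_dvd hp.out).2 h)
  exact mem_nonPowers.1 hx (x ^ m) (by rw [← pow_mul, mul_comm, pow_mul, hm])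

/-- The p-part of a p-th root of x * u would be a p-th root of x. -/
theorem mul_mem_nonPowers [Finite G] [Fact p.Prime] {x u : G} (hx : x ∈ nonPowers G p)
    (hxp : IsPElement p x) (hu : ¬ p ∣ orderOf u) (hc : Commute x u) : x * u ∈ nonPowers G p := by
  obtain ⟨N, M, -, -, -, h4, h5⟩ := exists_part_exponents G p
  rw [mem_nonPowers] at hx ⊢
  intro z hz
  refine hx (z ^ M) ?_
  rw [← pow_mul, mul_comm, pow_mul, hz, hc.mul_pow, (h4 x hxp).2, (h5 u hu).2, mul_one]

theorem mul_isPElement_iff [Finite G] [Fact p.Prime] {x u : G} (hxp : IsPElement p x)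
    (hu : ¬ p ∣ orderOf u) (hc : Commute x u) : IsPElement p (x * u) ↔ u = 1 := by
  obtain ⟨N, M, -, -, -, h4, h5⟩ := exists_part_exponents G p
  constructor
  · intro h
    have := (h4 _ h).1
    rwa [hc.mul_pow, (h4 x hxp).1, (h5 u hu).1, one_mul] at this
  · rintro rfl
    simpa using hxp

theorem exists_orderOf_eq_commute [Finite G] {w : G} (h : p ∣ orderOf w) :
    ∃ c : G, orderOf c = p ∧ Commute w c :=
  ⟨w ^ (orderOf w / p), orderOf_pow_orderOf_div (orderOf_pos w).ne' h, Commute.self_pow w _⟩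

end Basic

/-! ### Lower bounds from counting p-th roots. -/

section RootCount

variable {G : Type*} [Group G] {p : ℕ}

/-- If the `p`-th roots of elements of `S` can be multiplied by commuting elements of order `p`
within `S`, then `S` contains at most `|S| / p` many `p`-th powers. -/
theorem mul_ncard_le_of_roots [Finite G] (S : Set G)
    (h : ∀ w : G, w ^ p ∈ S → ∃ c : G, orderOf c = p ∧ Commute w c ∧ ∀ j : ℕ, w * c ^ j ∈ S) :
    p * S.ncard ≤ p * (S ∩ nonPowers G p).ncard + S.ncard := by
  classical
  have := Fintype.ofFinite G
  -- Each p-th power z = w ^ p in S has the p distinct roots w * c ^ j in S, and the root sets of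
  -- different z are disjoint.
  have key : p * (S \ nonPowers G p).ncard ≤ S.ncard := by
    rw [Set.ncard_eq_toFinset_card', Set.ncard_eq_toFinset_card', mul_comm, ← smul_eq_mul]
    refine (Finset.card_nsmul_le_sum _ (fun z => (S.toFinset.filter (fun w => w ^ p = z)).card) p
      ?_).trans ?_
    · intro z hz
      simp only [Set.mem_toFinset, Set.mem_sdiff, mem_nonPowers, not_forall, not_not] at hz
      obtain ⟨hzS, w, rfl⟩ := hz
      obtain ⟨c, hc, hwc, hj⟩ := h w hzS
      have : ((Finset.range p).image (fun j => w * c ^ j)).card = p := by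
        rw [Finset.card_image_of_injOn, Finset.card_range]
        intro i hi j hj hij
        refine pow_injOn_Iio_orderOf ?_ ?_ (mul_left_cancel hij)
        · simpa [hc] using hi
        · simpa [hc] using hj
      nth_rw 1 [← this]
      refine Finset.card_le_card fun g hg => ?_
      obtain ⟨j, -, rfl⟩ := Finset.mem_image.1 hg
      simp only [Finset.mem_filter, Set.mem_toFinset]
      refine ⟨hj j, ?_⟩
      rw [(hwc.pow_right j).mul_pow, ← pow_mul, mul_comm j, pow_mul, ← hc, pow_orderOf_eq_one,
        one_pow, mul_one]
    · rw [← Finset.card_biUnion]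
      · exact Finset.card_le_card (Finset.biUnion_subset.2 fun z _ => Finset.filter_subset _ _)
      · intro a _ b _ hab
        rw [Function.onFun, Finset.disjoint_left]
        intro g hg hg'
        exact hab ((Finset.mem_filter.1 hg).2.symm.trans (Finset.mem_filter.1 hg').2)
  have := Set.ncard_inter_add_ncard_sdiff_eq_ncard S (nonPowers G p)
  nlinarith

theorem ncard_isPElement_le [Finite G] [Fact p.Prime] (hdvd : p ∣ Nat.card G) :
    p * {g : G | IsPElement p g}.ncard ≤
      p * {g : G | IsPElement p g ∧ g ∈ nonPowers G p}.ncard + {g : G | IsPElement p g}.ncard := by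
  refine mul_ncard_le_of_roots _ fun w hw => ?_
  have hw' : IsPElement p w := isPElement_pow_iff.1 hw
  have : ∃ c : G, orderOf c = p ∧ Commute w c := by
    by_cases h : p ∣ orderOf w
    · exact exists_orderOf_eq_commute h
    -- Only w = 1 is both a p-element and a p'-element; Cauchy's theorem supplies c.
    · obtain ⟨c, hc⟩ := exists_prime_orderOf_dvd_card' (G := G) p hdvd
      obtain ⟨N, M, -, -, -, h4, h5⟩ := exists_part_exponents G p
      have : w = 1 := by rw [← (h5 w h).1, (h4 w hw').1]
      exact ⟨c, hc, this ▸ Commute.one_left c⟩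
  obtain ⟨c, hc, hwc⟩ := this
  refine ⟨c, hc, hwc, fun j => isPElement_pow_iff.1 ?_⟩
  rw [(hwc.pow_right j).mul_pow, ← pow_mul, mul_comm j, pow_mul, ← hc, pow_orderOf_eq_one,
    one_pow, mul_one, hc]
  exact hw

theorem isPElement_of_mem_sylow (P : Sylow p G) {g : G} (hg : g ∈ P) : IsPElement p g := by
  obtain ⟨k, hk⟩ := P.isPGroup' ⟨g, hg⟩
  exact ⟨k, by simpa using congrArg Subtype.val hk⟩

theorem ordProj_le_ncard_isPElement [Finite G] [Fact p.Prime] :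
    ordProj[p] (Nat.card G) ≤ {g : G | IsPElement p g}.ncard := by
  obtain ⟨P⟩ : Nonempty (Sylow p G) := inferInstance
  rw [← P.card_eq_multiplicity]
  exact Set.ncard_le_ncard (s := (P : Set G)) fun g hg => isPElement_of_mem_sylow P hg

/-- A lower bound for the number of non-powers that are not `p`-elements. -/
theorem ordProj_mul_le_of_not_isPElement [Finite G] [hp : Fact p.Prime] {y : G} (hy : y ∈ nonPowers G p)
    (hyp : ¬ IsPElement p y) :
    p * ordProj[p] (Nat.card G) ≤
      p * {g : G | ¬ IsPElement p g ∧ g ∈ nonPowers G p}.ncard + ordProj[p] (Nat.card G) := by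
  obtain ⟨N, M, h1, h2, h3, h4, h5⟩ := exists_part_exponents G p
  -- A p'-element has no power of order p, so the commuting element of order p is built into S.
  set S : Set G := {g | ¬ IsPElement p g ∧ ∃ c : G, orderOf c = p ∧ Commute g c} with hS
  have hroots : p * S.ncard ≤ p * (S ∩ nonPowers G p).ncard + S.ncard := by
    refine mul_ncard_le_of_roots _ fun w hw => ?_
    have : ∃ c : G, orderOf c = p ∧ Commute w c := by
      by_cases h : p ∣ orderOf w
      · exact exists_orderOf_eq_commute h
      · obtain ⟨-, c, hc, hwc⟩ := hw
        obtain ⟨m, hm⟩ := exists_pow_eq_self_of_coprime (n := p) (x := w)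
          ((Nat.Prime.coprime_iff_not_dvd hp.out).2 h)
        exact ⟨c, hc, hm ▸ hwc.pow_left m⟩
    obtain ⟨c, hc, hwc⟩ := this
    refine ⟨c, hc, hwc, fun j => ⟨fun hj => hw.1 ?_, c, hc, ?_⟩⟩
    · rw [← isPElement_pow_iff, (hwc.pow_right j).mul_pow, ← pow_mul, mul_comm j, pow_mul, ← hc,
        pow_orderOf_eq_one, one_pow, mul_one, hc] at hj
      exact hj
    · exact hwc.mul_left ((Commute.refl c).pow_left j)
  have hsub : (S ∩ nonPowers G p).ncard ≤ {g : G | ¬ IsPElement p g ∧ g ∈ nonPowers G p}.ncard :=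
    Set.ncard_le_ncard fun g hg => ⟨hg.1.1, hg.2⟩
  have hlarge : ordProj[p] (Nat.card G) ≤ S.ncard := by
    obtain ⟨c, hc, hyc⟩ := exists_orderOf_eq_commute (dvd_orderOf_of_mem_nonPowers hy)
    have hu1 : y ^ N ≠ 1 := fun h => hyp (by
      have := h1 y
      rw [h, one_mul] at this
      exact this ▸ h3 y)
    have huc : Commute (y ^ N) c := hyc.pow_left N
    have hup : ¬ p ∣ orderOf (y ^ N) := h2 y
    generalize y ^ N = u at hu1 huc hup
    obtain ⟨P⟩ : Nonempty (Sylow p G) := inferInstance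
    rw [← P.card_eq_multiplicity]
    set T : Subgroup P := (Subgroup.centralizer {u}).subgroupOf P with hT
    have hTc (s : T) : Commute ((s : P) : G) u := by
      have := Subgroup.mem_subgroupOf.1 s.2
      rwa [Subgroup.mem_centralizer_singleton_iff] at this
    have hTp (s : T) : IsPElement p ((s : P) : G) := isPElement_of_mem_sylow P (s : P).2
    -- With u the p'-part of y and T = C_P(u), these are the conjugates of s * u by coset
    -- representatives of T in P. The p'-part of the value determines the coset, and then s is
    -- determined, so S has at least |P| elements.
    let f : (P ⧸ T) × T → G := fun a => (a.1.out : G) * (((a.2 : P) : G) * u) * (a.1.out : G)⁻¹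
    have hfN (a) : f a ^ N = (a.1.out : G) * u * (a.1.out : G)⁻¹ := by
      simp only [f]
      rw [conj_pow, (hTc a.2).mul_pow, (h4 _ (hTp a.2)).1, (h5 u hup).1, one_mul]
    have hf : Function.Injective f := by
      rintro ⟨a, s⟩ ⟨b, r⟩ hab
      have h : (a.out : G) * u * (a.out : G)⁻¹ = (b.out : G) * u * (b.out : G)⁻¹ := by
        rw [← hfN (a, s), ← hfN (b, r), hab]
      have hab' : a = b := by
        rw [← Quotient.out_eq' a, ← Quotient.out_eq' b]
        change QuotientGroup.mk _ = QuotientGroup.mk _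
        rw [QuotientGroup.eq]
        refine Subgroup.mem_subgroupOf.2 (Subgroup.mem_centralizer_singleton_iff.2 ?_)
        push_cast
        have h' := congrArg (fun g => (a.out : G)⁻¹ * g * (b.out : G)) h
        simp only [mul_assoc, inv_mul_cancel, mul_one, inv_mul_cancel_left] at h'
        rw [mul_assoc, ← h']
      subst hab'
      simp only [f, mul_left_inj, mul_right_inj] at hab
      have : s = r := Subtype.ext (Subtype.ext hab)
      rw [this]
    have hle := Set.ncard_le_ncard (s := Set.range f) (t := S) ?_
    · rw [← Set.image_univ, Set.ncard_image_of_injective _ hf, Set.ncard_univ,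
        ← Nat.card_congr Subgroup.groupEquivQuotientProdSubgroup] at hle
      exact hle
    · rintro _ ⟨a, rfl⟩
      refine ⟨fun h => ?_, ?_⟩
      · have := (h4 _ h).1
        rw [hfN, conj_eq_one_iff] at this
        exact hu1 this
      · by_cases h : p ∣ orderOf (f a)
        · exact exists_orderOf_eq_commute h
        · refine ⟨(a.1.out : G) * c * (a.1.out : G)⁻¹, ?_, ?_⟩
          · exact (MulEquiv.orderOf_eq (MulAut.conj (a.1.out : G)) c).trans hc
          · have e := (h5 _ h).1
            rw [hfN] at e
            rw [← e]
            exact (Commute.conj_iff _).2 huc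
  have h2p := hp.out.two_le
  obtain ⟨p', rfl⟩ : ∃ p', p = p' + 1 := ⟨p - 1, by omega⟩
  have : p' * ordProj[p' + 1] (Nat.card G) ≤ p' * S.ncard := Nat.mul_le_mul_left _ hlarge
  have := Nat.mul_le_mul_left (p' + 1) hsub
  linarith

end RootCount

/-! ### A normal elementary abelian Sylow subgroup. -/

section NormalSylow

variable {G : Type*} [Group G] [Finite G] {p : ℕ} [hp : Fact p.Prime]

theorem exists_mem_sylow_of_isPElement {g : G} (hg : IsPElement p g) : ∃ P : Sylow p G, g ∈ P := by
  obtain ⟨k, hk⟩ := hg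
  have : IsPGroup p (Subgroup.zpowers g) := by
    rw [IsPGroup.iff_card, Nat.card_zpowers]
    exact ⟨_, ((Nat.dvd_prime_pow hp.out).1 (orderOf_dvd_of_pow_eq_one hk)).choose_spec.2⟩
  obtain ⟨P, hP⟩ := this.exists_le_sylow
  exact ⟨P, hP (Subgroup.mem_zpowers g)⟩

/-- If there are few `p`-elements that are not `p`-th powers, the Sylow `p`-subgroup is unique. -/
theorem sylow_eq_of_ncard_lt (hp3 : 3 ≤ p) (hdvd : p ∣ Nat.card G)
    (hk : {g : G | IsPElement p g ∧ g ∈ nonPowers G p}.ncard < ordProj[p] (Nat.card G))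
    (P Q : Sylow p G) : P = Q := by
  by_contra hPQ
  have hW := ncard_isPElement_le (G := G) hdvd
  have hunion : ((P : Set G) ∪ Q).ncard ≤ {g : G | IsPElement p g}.ncard :=
    Set.ncard_le_ncard fun g hg =>
      hg.elim (fun h => isPElement_of_mem_sylow P h) (fun h => isPElement_of_mem_sylow Q h)
  have hie := Set.ncard_union_add_ncard_inter (P : Set G) Q
  have hP : (P : Set G).ncard = ordProj[p] (Nat.card G) := P.card_eq_multiplicity
  have hQ : (Q : Set G).ncard = ordProj[p] (Nat.card G) := Q.card_eq_multiplicity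
  have hinter : p * ((P : Set G) ∩ Q).ncard ≤ ordProj[p] (Nat.card G) := by
    have hdv : Nat.card ((P : Subgroup G) ⊓ Q : Subgroup G) ∣ Nat.card (P : Subgroup G) :=
      Subgroup.card_dvd_of_le inf_le_left
    have hne : Nat.card ((P : Subgroup G) ⊓ Q : Subgroup G) ≠ Nat.card (P : Subgroup G) := by
      intro h
      have h1 := Subgroup.eq_of_le_of_card_ge (inf_le_left : (P : Subgroup G) ⊓ Q ≤ P) h.ge
      exact hPQ (Sylow.ext (P.3 Q.2 (inf_eq_left.1 h1)).symm)
    rw [P.card_eq_multiplicity] at hdv hne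
    obtain ⟨i, hi, hi'⟩ := (Nat.dvd_prime_pow hp.out).1 hdv
    have hlt : i < (Nat.card G).factorization p :=
      lt_of_le_of_ne hi fun h => hne (by rw [hi', h])
    have : ((P : Set G) ∩ Q).ncard = p ^ i := hi'
    rw [this, ← pow_succ']
    exact Nat.pow_le_pow_right hp.out.pos hlt
  rw [hP, hQ] at hie
  generalize ((P : Set G) ∩ Q).ncard = d at *
  generalize ((P : Set G) ∪ Q).ncard = e at *
  generalize ordProj[p] (Nat.card G) = q at *
  generalize {g : G | IsPElement p g}.ncard = w at *
  generalize {g : G | IsPElement p g ∧ g ∈ nonPowers G p}.ncard = k at *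
  obtain ⟨s, rfl⟩ : ∃ s, p = s + 3 := ⟨p - 3, by omega⟩
  have h1 : (s + 2) * w ≤ (s + 3) * k := by linarith
  -- With p = s + 3 this says (p - 1)(2p - 1)q ≤ p²k. As k < q, it would force p² - 3p + 1 < 0,
  -- which fails for p ≥ 3.
  have h2 : (s + 3) * ((s + 2) * (2 * q)) ≤ (s + 3) * ((s + 3) * k) + (s + 2) * q := by
    calc (s + 3) * ((s + 2) * (2 * q)) = (s + 3) * ((s + 2) * e) + (s + 2) * ((s + 3) * d) := by
          rw [show 2 * q = e + d by omega]; ring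
      _ ≤ _ := Nat.add_le_add
          (Nat.mul_le_mul_left _ ((Nat.mul_le_mul_left _ hunion).trans h1))
          (Nat.mul_le_mul_left _ hinter)
  have h3 : (s + 3) * ((s + 3) * (k + 1)) ≤ (s + 3) * ((s + 3) * q) := by gcongr; omega
  nlinarith

/-- If the `p`-elements that are not `p`-th powers are few and centralized by Sylow
`p`-subgroups, then the Sylow `p`-subgroup is normal and elementary abelian. -/
theorem exists_normal_elementary_sylow (hp3 : 3 ≤ p) (hdvd : p ∣ Nat.card G)
    (hk : {g : G | IsPElement p g ∧ g ∈ nonPowers G p}.ncard < ordProj[p] (Nat.card G))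
    (hpk : ¬ p ∣ {g : G | IsPElement p g ∧ g ∈ nonPowers G p}.ncard)
    (hcent : ∀ g : G, IsPElement p g → g ∈ nonPowers G p →
      ordProj[p] (Nat.card G) ∣ Nat.card (Subgroup.centralizer {g})) :
    ∃ P : Subgroup G, P.Normal ∧ Nat.card P = ordProj[p] (Nat.card G) ∧
      (∀ g : G, g ∈ P ↔ IsPElement p g) ∧ (∀ g ∈ P, ∀ h ∈ P, Commute g h) ∧
      (∀ g ∈ P, g ≠ 1 → g ∈ nonPowers G p) ∧ (∀ g ∈ P, g ^ p = 1) ∧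
      {g : G | IsPElement p g ∧ g ∈ nonPowers G p}.ncard + 1 = ordProj[p] (Nat.card G) := by
  have huniq := sylow_eq_of_ncard_lt hp3 hdvd hk
  obtain ⟨P⟩ : Nonempty (Sylow p G) := inferInstance
  have hmem (g : G) : g ∈ P ↔ IsPElement p g := by
    refine ⟨isPElement_of_mem_sylow P, fun h => ?_⟩
    obtain ⟨Q, hQ⟩ := exists_mem_sylow_of_isPElement h
    exact huniq Q P ▸ hQ
  have hcardP : Nat.card (P : Subgroup G) = ordProj[p] (Nat.card G) := P.card_eq_multiplicity
  have hnormal : (P : Subgroup G).Normal :=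
    ⟨fun g hg c => (hmem _).2 (((hmem g).1 hg).isConj (isConj_iff.2 ⟨c, rfl⟩))⟩
  -- A subgroup of order q in the centralizer of g is a Sylow subgroup of G, hence equals P.
  have hcentral (g : G) (hg : IsPElement p g) (hg' : g ∈ nonPowers G p) :
      (P : Subgroup G) ≤ Subgroup.centralizer {g} := by
    obtain ⟨K, hK⟩ := Sylow.exists_subgroup_card_pow_prime (G := Subgroup.centralizer {g}) p
      (hcent g hg hg')
    let L := K.map (Subgroup.centralizer {g}).subtype
    have hL : Nat.card L = ordProj[p] (Nat.card G) := by
      rw [← hK]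
      exact Subgroup.card_map_of_injective (Subgroup.subtype_injective _)
    have : (Sylow.ofCard L hL : Subgroup G) = P := by rw [huniq (Sylow.ofCard L hL) P]
    rw [← this]
    exact Subgroup.map_subtype_le K
  have hW := ncard_isPElement_le (G := G) hdvd
  have hWP : {g : G | IsPElement p g} = (P : Set G) := Set.ext fun g => ((hmem g).symm)
  have hPn : (P : Set G).ncard = ordProj[p] (Nat.card G) := hcardP
  rw [hWP, hPn] at hW
  have hcomm : ∀ g ∈ P, ∀ h ∈ P, Commute g h := by
    -- The center Z of P contains all k non-power p-elements. If it were proper then 2k ≤ q, against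
    -- (p - 1)q ≤ pk with p ≥ 3.
    set Z : Subgroup G := (P : Subgroup G) ⊓ Subgroup.centralizer (P : Set G) with hZ
    have hle : {g : G | IsPElement p g ∧ g ∈ nonPowers G p}.ncard ≤ Nat.card Z := by
      refine Set.ncard_le_ncard (t := (Z : Set G)) fun g hg => ⟨(hmem g).2 hg.1, ?_⟩
      refine Subgroup.mem_centralizer_iff.2 ?_
      intro h hh
      exact (Subgroup.mem_centralizer_singleton_iff.1 (hcentral g hg.1 hg.2 hh))
    have hZP : Z = P := by
      by_contra hne
      have hlt : Nat.card Z ≠ Nat.card (P : Subgroup G) := fun h =>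
        hne (Subgroup.eq_of_le_of_card_ge inf_le_left h.ge)
      obtain ⟨c, hc⟩ := Subgroup.card_dvd_of_le (inf_le_left : Z ≤ (P : Subgroup G))
      have hc2 : 2 ≤ c := by
        rcases c with _ | _ | c
        · have := Nat.card_pos (α := (P : Subgroup G))
          omega
        · exact absurd (by rw [hc, zero_add, mul_one]) hlt
        · omega
      rw [hcardP] at hc
      have h0 : 0 < ordProj[p] (Nat.card G) := pow_pos hp.out.pos _
      generalize ordProj[p] (Nat.card G) = q at *
      generalize {g : G | IsPElement p g ∧ g ∈ nonPowers G p}.ncard = k at *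
      have : 2 * k ≤ q := by rw [hc]; nlinarith
      nlinarith
    intro g hg h hh
    have hg' : g ∈ Z := hZP ▸ hg
    exact (Subgroup.mem_centralizer_iff.1 hg'.2 h hh).symm
  have hexp : ∀ g ∈ P, g ^ p = 1 := by
    -- The p-th power map of the abelian group P has an image of q - k elements. A nontrivial image
    -- would have order divisible by p, as is q, so p would divide k.
    let f : (P : Subgroup G) →* G :=
      { toFun := fun g => (g : G) ^ p
        map_one' := by simp
        map_mul' := fun a b => by
          rw [Subgroup.coe_mul]; exact (hcomm a a.2 b b.2).mul_pow p }
    have hrange : (f.range : Set G) = (P : Set G) \ {g : G | IsPElement p g ∧ g ∈ nonPowers G p} := by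
      ext g
      simp only [SetLike.mem_coe, MonoidHom.mem_range, Set.mem_sdiff, Set.mem_ofPred_eq, not_and]
      constructor
      · rintro ⟨a, rfl⟩
        exact ⟨Subgroup.pow_mem _ a.2 p, fun _ h => mem_nonPowers.1 h a rfl⟩
      · rintro ⟨hg, hg'⟩
        have hg1 := (hmem g).1 hg
        have := hg' hg1
        rw [mem_nonPowers] at this
        push Not at this
        obtain ⟨w, rfl⟩ := this
        exact ⟨⟨w, (hmem w).2 (isPElement_pow_iff.1 hg1)⟩, rfl⟩
    have hsub : {g : G | IsPElement p g ∧ g ∈ nonPowers G p} ⊆ (P : Set G) :=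
      fun g hg => (hmem g).2 hg.1
    have hcnt := Set.ncard_sdiff_add_ncard_of_subset hsub
    rw [← hrange, hPn] at hcnt
    have hle : f.range ≤ (P : Subgroup G) := by
      rintro _ ⟨a, rfl⟩
      exact Subgroup.pow_mem _ a.2 p
    have hbot : f.range = ⊥ := by
      rw [← Subgroup.card_eq_one]
      by_contra hne
      obtain ⟨i, hi, hi'⟩ := (Nat.dvd_prime_pow hp.out).1
        (hcardP ▸ Subgroup.card_dvd_of_le hle)
      have hi0 : i ≠ 0 := by rintro rfl; exact hne (by simpa using hi')
      have h1 : p ∣ (f.range : Set G).ncard := by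
        change p ∣ Nat.card f.range
        rw [hi']; exact dvd_pow_self p hi0
      have h2 : p ∣ ordProj[p] (Nat.card G) := dvd_pow_self p (by omega)
      rw [← hcnt] at h2
      exact hpk ((Nat.dvd_add_right h1).1 h2)
    intro g hg
    have : f ⟨g, hg⟩ ∈ f.range := ⟨_, rfl⟩
    rw [hbot] at this
    exact this
  have hnon : ∀ g ∈ P, g ≠ 1 → g ∈ nonPowers G p := by
    intro g hg hg1
    rw [mem_nonPowers]
    rintro w rfl
    exact hg1 (hexp w ((hmem w).2 (isPElement_pow_iff.1 ((hmem _).1 hg))))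
  refine ⟨P, hnormal, hcardP, hmem, hcomm, hnon, hexp, ?_⟩
  have : {g : G | IsPElement p g ∧ g ∈ nonPowers G p} = (P : Set G) \ {1} := by
    ext g
    simp only [Set.mem_ofPred_eq, Set.mem_sdiff, SetLike.mem_coe, Set.mem_singleton_iff, ← hmem]
    constructor
    · rintro ⟨h1, h2⟩
      exact ⟨h1, by rintro rfl; exact mem_nonPowers.1 h2 1 (one_pow p)⟩
    · rintro ⟨h1, h2⟩
      exact ⟨h1, hnon g h1 h2⟩
  rw [this, ← hPn]
  exact Set.ncard_sdiff_singleton_add_one (one_mem P)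

end NormalSylow

/-! ### A centralizer criterion for Frobenius groups. -/

section Frobenius

/-- Schur–Zassenhaus provides a complement H; an element of H commuting with a nonidentity element
of K lies in K ∩ H = 1. -/
theorem isFrobeniusGroup_of_centralizer_le {F : Type*} [Group F] [Finite F] (K : Subgroup F)
    [K.Normal] (hK : K ≠ ⊥) (hK' : K ≠ ⊤) (hcop : (Nat.card K).Coprime K.index)
    (hcent : ∀ k ∈ K, k ≠ 1 → ∀ g : F, Commute g k → g ∈ K) : IsFrobeniusGroup F := by
  obtain ⟨H, hH⟩ := Subgroup.exists_right_complement'_of_coprime hcop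
  refine ⟨inferInstance, K, H, inferInstance, hK, ?_, hH, fun h hh hh1 k hk hk1 he => hh1 ?_⟩
  · rintro rfl
    exact hK' (Subgroup.isComplement'_bot_right.1 hH)
  · have hhK : h ∈ K := hcent k hk hk1 h (mul_inv_eq_iff_eq_mul.1 he)
    exact Subgroup.disjoint_def.1 hH.disjoint hhK hh

end Frobenius

/-! ### Two classes of p-elements. -/

section Cases

variable {G : Type*} [Group G] [Finite G] {p : ℕ} [hp : Fact p.Prime]

theorem exists_isConj_of_length_eq_two {G : Type*} [Group G] {k : ℕ} (h : length G k = 2) :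
    ∃ x y : G, ¬ IsConj x y ∧ nonPowerClasses G k = {ConjClasses.mk x, ConjClasses.mk y} ∧
      nonPowers G k = {z | IsConj x z} ∪ {z | IsConj y z} := by
  obtain ⟨c, d, hcd, he⟩ := Set.ncard_eq_two.1 h
  obtain ⟨x, rfl⟩ := ConjClasses.exists_rep c
  obtain ⟨y, rfl⟩ := ConjClasses.exists_rep d
  refine ⟨x, y, fun h => hcd (ConjClasses.mk_eq_mk_iff_isConj.2 h), he, ?_⟩
  ext z
  have hz : z ∈ nonPowers G k ↔ ConjClasses.mk z ∈ nonPowerClasses G k := by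
    constructor
    · intro hz w hw
      exact conj_mem_nonPowers (ConjClasses.mk_eq_mk_iff_isConj.1
        (ConjClasses.mem_carrier_iff_mk_eq.1 hw).symm) hz
    · intro hz
      exact hz ConjClasses.mem_carrier_mk
  rw [hz, he]
  simp only [Set.mem_insert_iff, Set.mem_singleton_iff, ConjClasses.mk_eq_mk_iff_isConj,
    Set.mem_union, Set.mem_ofPred_eq]
  rw [isConj_comm, isConj_comm (g := z)]

theorem type_eq_of_classes [DecidableEq (ConjClasses G)] {x y : G} {k : ℕ} (hxy : ¬ IsConj x y)
    (h : nonPowerClasses G k = {ConjClasses.mk x, ConjClasses.mk y})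
    (hle : orderOf x ≤ orderOf y) : type G k = [orderOf x, orderOf y] := by
  have hne : ConjClasses.mk x ≠ ConjClasses.mk y := fun h =>
    hxy (ConjClasses.mk_eq_mk_iff_isConj.1 h)
  have e : (nonPowerClasses G k).toFinite.toFinset = {ConjClasses.mk x, ConjClasses.mk y} := by
    ext c
    simp [h]
  have hv : ({ConjClasses.mk x, ConjClasses.mk y} : Finset (ConjClasses G)).val =
      ConjClasses.mk x ::ₘ {ConjClasses.mk y} := by
    rw [Finset.insert_val_of_notMem (by simpa using hne)]
    rfl
  rw [type, e, hv, Multiset.map_cons, Multiset.map_singleton, Multiset.sort_cons,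
    Multiset.sort_singleton]
  · rfl
  · intro b hb
    rw [Multiset.mem_singleton.1 hb]
    exact hle

theorem exists_card_centralizer_eq_pow {x : G}
    (h : ∀ u : G, Commute x u → ¬ p ∣ orderOf u → u = 1) :
    ∃ i ≤ (Nat.card G).factorization p, Nat.card (Subgroup.centralizer {x}) = p ^ i := by
  have hpow := Nat.eq_prime_pow_of_unique_prime_dvd (p := p)
    (n := Nat.card (Subgroup.centralizer {x})) Nat.card_pos.ne' (by
      intro d hd hdvd
      by_contra hdp
      have := Fact.mk hd
      obtain ⟨u, hu⟩ := exists_prime_orderOf_dvd_card' d hdvd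
      have hu' : orderOf (u : G) = d := by rw [← hu]; exact Subgroup.orderOf_coe u
      have hu1 : (u : G) = 1 := by
        refine h u (Subgroup.mem_centralizer_singleton_iff.1 u.2).symm ?_
        rw [hu', Nat.prime_dvd_prime_iff_eq hp.out hd]
        exact fun h => hdp h.symm
      rw [hu1, orderOf_one] at hu'
      exact hd.one_lt.ne hu')
  refine ⟨_, ?_, hpow⟩
  rw [← hp.out.pow_dvd_iff_le_factorization Nat.card_pos.ne', ← hpow]
  exact Subgroup.card_subgroup_dvd_card _

theorem ordProj_mul_le_of_isPElement (hdvd : p ∣ Nat.card G) :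
    p * ordProj[p] (Nat.card G) ≤
      p * {g : G | IsPElement p g ∧ g ∈ nonPowers G p}.ncard + ordProj[p] (Nat.card G) := by
  have h1 := ncard_isPElement_le (G := G) hdvd
  have h2 := ordProj_le_ncard_isPElement (G := G) (p := p)
  obtain ⟨s, hs⟩ : ∃ s, p = s + 1 := ⟨p - 1, by have := hp.out.two_le; omega⟩
  generalize ordProj[p] (Nat.card G) = q at *
  generalize {g : G | IsPElement p g}.ncard = w at *
  generalize {g : G | IsPElement p g ∧ g ∈ nonPowers G p}.ncard = k at *
  subst hs
  have := Nat.mul_le_mul_left s h2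
  linarith

theorem exists_isPElement_mem_nonPowers (hdvd : p ∣ Nat.card G) :
    ∃ g : G, IsPElement p g ∧ g ∈ nonPowers G p := by
  have h := ordProj_mul_le_of_isPElement (G := G) hdvd
  have hq : 0 < ordProj[p] (Nat.card G) := pow_pos hp.out.pos _
  have h2 := hp.out.two_le
  by_contra hne
  push Not at hne
  have : {g : G | IsPElement p g ∧ g ∈ nonPowers G p} = ∅ :=
    Set.eq_empty_of_forall_notMem fun g hg => hne g hg.1 hg.2
  rw [this, Set.ncard_empty] at h
  nlinarith

/-- The factor c allows for centralizers of order q (c = 1) and 2q (c = 2). -/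
theorem not_dvd_of_mul_ordProj_eq {n₁ c : ℕ} (h : n₁ * (c * ordProj[p] (Nat.card G)) = Nat.card G) :
    ¬ p ∣ n₁ := by
  intro hd
  have h1 := Nat.not_dvd_ordCompl hp.out (Nat.card_pos (α := G)).ne'
  refine h1 ?_
  have h0 : 0 < ordProj[p] (Nat.card G) := pow_pos hp.out.pos _
  have h2 := Nat.ordProj_mul_ordCompl_eq_self (Nat.card G) p
  have h3 : ordCompl[p] (Nat.card G) = n₁ * c := by
    refine Nat.eq_of_mul_eq_mul_left h0 ?_
    rw [h2]
    nth_rw 1 [← h]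
    ring
  rw [h3]
  exact hd.mul_right c

/-- If i < j then p * n₂ ≤ n₁, so with n = n₁ + n₂ the upper bound on n² gives (p + 1)n < 2p^m. The
lower bound pn ≥ (p - 1)p^m then contradicts p ≥ 3. -/
theorem not_lt_of_two_prime_power_classes {p i j m n₁ n₂ c : ℕ} (hp3 : 3 ≤ p) (hj : j ≤ m)
    (h1 : n₁ * p ^ i = c) (h2 : n₂ * p ^ j = c) (hc : (n₁ + n₂) ^ 2 < 2 * c)
    (hl : p * p ^ m ≤ p * (n₁ + n₂) + p ^ m) : ¬ i < j := by
  intro hij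
  have hn : n₁ = n₂ * p ^ (j - i) := by
    refine Nat.eq_of_mul_eq_mul_right (pow_pos (by omega : 0 < p) i) ?_
    rw [h1, ← h2, mul_assoc, ← pow_add, Nat.sub_add_cancel hij.le]
  have hpp : p ≤ p ^ (j - i) := Nat.le_self_pow (by omega) p
  have hn' : p * n₂ ≤ n₁ := by rw [hn, mul_comm]; exact Nat.mul_le_mul_left _ hpp
  have hjm : p ^ j ≤ p ^ m := Nat.pow_le_pow_right (by omega) hj
  have h3 : n₂ * ((n₁ + n₂) * (p + 1)) < n₂ * (2 * p ^ m) := by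
    calc n₂ * ((n₁ + n₂) * (p + 1)) = (n₁ + n₂) * (p * n₂ + n₂) := by ring
      _ ≤ (n₁ + n₂) ^ 2 := by rw [sq]; gcongr
      _ < 2 * c := hc
      _ = n₂ * (2 * p ^ j) := by rw [← h2]; ring
      _ ≤ _ := by gcongr
  have h4 := Nat.lt_of_mul_lt_mul_left h3
  generalize p ^ m = q at *
  generalize n₁ + n₂ = n at *
  have h5 : (p + 1) * (p * q) ≤ p * (n * (p + 1)) + (p + 1) * q := by
    have := Nat.mul_le_mul_left (p + 1) hl
    linarith
  have h6 : p * (n * (p + 1)) ≤ p * (2 * q) := Nat.mul_le_mul_left _ h4.le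
  have h7 : q * (p * p) ≤ q * (2 * p + 1) := by linarith
  have hq : 0 < q := by omega
  have := Nat.le_of_mul_le_mul_left h7 hq
  nlinarith

/-- The structure of `G` when the elements that are not `p`-th powers are two classes of
`p`-elements. -/
theorem frobenius_of_forall_isPElement (hp3 : 3 ≤ p) (hdvd : p ∣ Nat.card G) {x y : G}
    (hxy : ¬ IsConj x y) (hN : nonPowers G p = {z | IsConj x z} ∪ {z | IsConj y z})
    (hall : ∀ z ∈ nonPowers G p, IsPElement p z)
    (hcard : (nonPowers G p).ncard ^ 2 < 2 * Nat.card G) :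
    orderOf x = p ∧ orderOf y = p ∧
      2 * Nat.card G = (nonPowers G p).ncard * ((nonPowers G p).ncard + 1) ∧
      (Nat.card G ≠ 3 → IsFrobeniusGroup G) := by
  -- A nonidentity p'-element u commuting with z would make z * u a non-power that is not a
  -- p-element.
  have hpow (z : G) (hz : z ∈ nonPowers G p) :
      ∃ i ≤ (Nat.card G).factorization p, Nat.card (Subgroup.centralizer {z}) = p ^ i :=
    exists_card_centralizer_eq_pow fun u hu hu' =>
      (mul_isPElement_iff (hall z hz) hu' hu).1
        (hall _ (mul_mem_nonPowers hz (hall z hz) hu' hu))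
  have hxN : x ∈ nonPowers G p := by rw [hN]; exact Or.inl (IsConj.refl x)
  have hyN : y ∈ nonPowers G p := by rw [hN]; exact Or.inr (IsConj.refl y)
  obtain ⟨i, hi, hi'⟩ := hpow x hxN
  obtain ⟨j, hj, hj'⟩ := hpow y hyN
  have h1 := ncard_conj_mul_card_centralizer x
  have h2 := ncard_conj_mul_card_centralizer y
  have hdisj : Disjoint {z | IsConj x z} {z | IsConj y z} :=
    Set.disjoint_left.2 fun z hz hz' => hxy (hz.trans hz'.symm)
  have hsum : (nonPowers G p).ncard = {z | IsConj x z}.ncard + {z | IsConj y z}.ncard := by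
    rw [hN, Set.ncard_union_eq hdisj]
  have hset : {g : G | IsPElement p g ∧ g ∈ nonPowers G p} = nonPowers G p :=
    Set.ext fun g => ⟨fun h => h.2, fun h => ⟨hall g h, h⟩⟩
  have hl := ordProj_mul_le_of_isPElement (G := G) hdvd
  rw [hset] at hl
  rw [hi'] at h1
  rw [hj'] at h2
  have hij : i = j := by
    have a1 := not_lt_of_two_prime_power_classes hp3 hj h1 h2 (hsum ▸ hcard) (hsum ▸ hl)
    have a2 := not_lt_of_two_prime_power_classes hp3 hi h2 h1
      (by rw [add_comm, ← hsum]; exact hcard) (by rw [add_comm {z | IsConj y z}.ncard, ← hsum]; exact hl)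
    omega
  subst hij
  have hpi : 0 < p ^ i := pow_pos hp.out.pos _
  have heq : {z | IsConj y z}.ncard = {z | IsConj x z}.ncard :=
    Nat.eq_of_mul_eq_mul_right hpi (h2.trans h1.symm)
  rw [heq] at hsum
  have hlt : (nonPowers G p).ncard < p ^ i := by
    rw [← h1, hsum] at hcard
    rw [hsum]
    generalize {z | IsConj x z}.ncard = a at *
    nlinarith
  -- Otherwise p * p ^ i ≤ q, whereas (p - 1)q ≤ pn < p * p ^ i.
  have him : i = (Nat.card G).factorization p := by
    by_contra hne
    have : p * p ^ i ≤ ordProj[p] (Nat.card G) := by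
      rw [← pow_succ']
      exact Nat.pow_le_pow_right hp.out.pos (by omega)
    generalize ordProj[p] (Nat.card G) = q at *
    generalize p ^ i = b at *
    nlinarith
  subst him
  have hcentcard (z : G) (hz : z ∈ nonPowers G p) :
      Nat.card (Subgroup.centralizer {z}) = ordProj[p] (Nat.card G) := by
    rw [hN] at hz
    rcases hz with hz | hz
    · rw [← card_centralizer_eq_of_isConj hz, hi']
    · rw [← card_centralizer_eq_of_isConj hz, hj']
  have hpn : ¬ p ∣ {z | IsConj x z}.ncard :=
    not_dvd_of_mul_ordProj_eq (G := G) (c := 1) (by rw [one_mul]; exact h1)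
  obtain ⟨P, hnorm, hPcard, hmem, hcomm, hnon, hexp, hk⟩ :=
    exists_normal_elementary_sylow hp3 hdvd (by rw [hset]; exact hlt) (by
      rw [hset, hsum, ← two_mul]
      intro h
      rcases hp.out.dvd_mul.1 h with h | h
      · have := Nat.le_of_dvd (by norm_num) h
        omega
      · exact hpn h) fun g _ hg => (hcentcard g hg).symm ▸ dvd_rfl
  rw [hset] at hk
  have horder (z : G) (hz : z ∈ nonPowers G p) : orderOf z = p := by
    refine orderOf_eq_prime (hexp z ((hmem z).2 (hall z hz))) ?_
    rintro rfl
    exact mem_nonPowers.1 hz 1 (one_pow p)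
  have hG : 2 * Nat.card G = (nonPowers G p).ncard * ((nonPowers G p).ncard + 1) := by
    rw [← h1, hk, hsum]
    ring
  refine ⟨horder x hxN, horder y hyN, hG, fun hG3 => ?_⟩
  refine isFrobeniusGroup_of_centralizer_le P ?_ ?_ ?_ ?_
  · rintro rfl
    have : x ∈ (⊥ : Subgroup G) := (hmem x).2 (hall x hxN)
    rw [Subgroup.mem_bot] at this
    exact mem_nonPowers.1 hxN 1 (by rw [this, one_pow])
  -- If P = G then n + 1 = |G|, and 2|G| = n(n + 1) gives n = 2, the excluded order 3.
  · rintro rfl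
    rw [Subgroup.card_top] at hPcard
    have : (nonPowers G p).ncard + 1 = Nat.card G := hk.trans hPcard.symm
    rw [this] at hG
    have := Nat.eq_of_mul_eq_mul_right Nat.card_pos hG
    omega
  · rw [hPcard]
    refine Nat.Coprime.pow_left _ ((Nat.Prime.coprime_iff_not_dvd hp.out).2 ?_)
    have := P.index_mul_card
    rw [hPcard] at this
    exact not_dvd_of_mul_ordProj_eq (G := G) (c := 1) (by rw [one_mul]; exact this)
  · intro k hk hk1 g hg
    have hle : P ≤ Subgroup.centralizer {k} := fun h hh =>
      Subgroup.mem_centralizer_singleton_iff.2 (hcomm h hh k hk)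
    rw [Subgroup.eq_of_le_of_card_ge hle (by rw [hcentcard k (hnon k hk hk1), hPcard])]
    exact Subgroup.mem_centralizer_singleton_iff.2 hg

end Cases

/-! ### A class of p-elements and a class of other elements. -/

section Mixed

variable {G : Type*} [Group G] [Finite G] {p : ℕ} [hp : Fact p.Prime]

/-- The nonidentity `p'`-elements commuting with `x`. -/
def regularCentralizer {G : Type*} [Group G] (p : ℕ) (x : G) : Set G :=
  {u | Commute x u ∧ ¬ p ∣ orderOf u ∧ u ≠ 1}

theorem conj_mem_regularCentralizer {G : Type*} [Group G] {p : ℕ} {x u : G} (c : G)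
    (hu : u ∈ regularCentralizer p x) :
    c * u * c⁻¹ ∈ regularCentralizer p (c * x * c⁻¹) := by
  refine ⟨(Commute.conj_iff c).2 hu.1, ?_, fun h => hu.2.2 (conj_eq_one_iff.1 h)⟩
  have : orderOf (c * u * c⁻¹) = orderOf u := MulEquiv.orderOf_eq (MulAut.conj c) u
  rw [this]
  exact hu.2.1

/-- Conjugates of the products x * u are counted: the p-part recovers the conjugate of x, and then
u. -/
theorem ncard_mul_regularCentralizer_le {x : G} (hx : x ∈ nonPowers G p)
    (hxp : IsPElement p x) :
    {z | IsConj x z}.ncard * (regularCentralizer p x).ncard ≤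
      {g : G | ¬ IsPElement p g ∧ g ∈ nonPowers G p}.ncard := by
  obtain ⟨N, M, -, -, -, h4, h5⟩ := exists_part_exponents G p
  have hex (z : {z | IsConj x z}) : ∃ c : G, c * x * c⁻¹ = z := isConj_iff.1 z.2
  choose c hc using hex
  let f : {z | IsConj x z} × regularCentralizer p x → G :=
    fun a => c a.1 * (x * a.2) * (c a.1)⁻¹
  have hfM (a) : f a ^ M = a.1 := by
    simp only [f]
    rw [conj_pow, (a.2.2.1).mul_pow, (h4 x hxp).2, (h5 _ a.2.2.2.1).2, mul_one, hc]
  have hf : Function.Injective f := by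
    rintro ⟨z, u⟩ ⟨w, v⟩ h
    have hzw : z = w := Subtype.ext (by rw [← hfM (z, u), ← hfM (w, v), h])
    subst hzw
    simp only [f, mul_left_inj, mul_right_inj] at h
    rw [Subtype.ext h]
  have hle := Set.ncard_le_ncard (s := Set.range f)
    (t := {g : G | ¬ IsPElement p g ∧ g ∈ nonPowers G p}) (by
      rintro _ ⟨⟨z, u, hu⟩, rfl⟩
      have hconj : IsConj (x * u) (f (z, ⟨u, hu⟩)) := isConj_iff.2 ⟨c z, rfl⟩
      exact ⟨fun h => hu.2.2 ((mul_isPElement_iff hxp hu.2.1 hu.1).1 (h.isConj hconj.symm)),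
        conj_mem_nonPowers hconj (mul_mem_nonPowers hx hxp hu.2.1 hu.1)⟩)
  rw [← Set.image_univ, Set.ncard_image_of_injective _ hf, Set.ncard_univ, Nat.card_prod] at hle
  exact hle

/-- If all the `p'`-elements in the centralizer of `x` have the same order, their number
bounds the part of the order of the centralizer that is prime to `p`. -/
theorem card_centralizer_le {x : G} {r : ℕ} (hr : r.Prime) (hrp : r ≠ p)
    (h : ∀ u ∈ regularCentralizer p x, orderOf u = r) :
    ∃ i ≤ (Nat.card G).factorization p, ∃ j, Nat.card (Subgroup.centralizer {x}) = p ^ i * r ^ j ∧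
      r ^ j ≤ (regularCentralizer p x).ncard + 1 := by
  set C := Subgroup.centralizer {x} with hC
  have hCpos : Nat.card C ≠ 0 := Nat.card_pos.ne'
  have hpow := Nat.eq_prime_pow_of_unique_prime_dvd (p := r) (n := ordCompl[p] (Nat.card C))
    (Nat.ordCompl_pos p hCpos).ne' (by
      intro d hd hdvd
      have := Fact.mk hd
      obtain ⟨u, hu⟩ := exists_prime_orderOf_dvd_card' (G := C) d
        (hdvd.trans (Nat.ordCompl_dvd _ p))
      have hu' : orderOf (u : G) = d := by rw [← hu]; exact Subgroup.orderOf_coe u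
      rw [← hu']
      refine h u ⟨(Subgroup.mem_centralizer_singleton_iff.1 u.2).symm, ?_, ?_⟩
      · rw [hu', Nat.prime_dvd_prime_iff_eq hp.out hd]
        rintro rfl
        exact Nat.not_dvd_ordCompl hp.out hCpos hdvd
      · intro h1
        rw [h1, orderOf_one] at hu'
        exact hd.one_lt.ne hu')
  refine ⟨(Nat.card C).factorization p, ?_,
    (ordCompl[p] (Nat.card C)).primeFactorsList.length, ?_, ?_⟩
  · exact (Nat.factorization_le_iff_dvd hCpos Nat.card_pos.ne').2
      (Subgroup.card_subgroup_dvd_card C) p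
  · rw [← hpow, Nat.ordProj_mul_ordCompl_eq_self]
  · have := Fact.mk hr
    obtain ⟨K, hK⟩ := Sylow.exists_subgroup_card_pow_prime (G := C) r
      (n := (ordCompl[p] (Nat.card C)).primeFactorsList.length)
      (by rw [← hpow]; exact Nat.ordCompl_dvd _ p)
    have hL : Nat.card (K.map C.subtype) = Nat.card K :=
      Subgroup.card_map_of_injective (Subgroup.subtype_injective _)
    rw [← hK, ← hL]
    refine (Set.ncard_le_ncard (s := (K.map C.subtype : Set G))
      (t := insert 1 (regularCentralizer p x)) ?_).trans (Set.ncard_insert_le _ _)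
    rintro _ ⟨u, hu, rfl⟩
    by_cases hu1 : (u : G) = 1
    · exact Or.inl hu1
    · refine Or.inr ⟨(Subgroup.mem_centralizer_singleton_iff.1 u.2).symm, fun hd => ?_, hu1⟩
      have h1 : orderOf (u : G) ∣ r ^ (ordCompl[p] (Nat.card C)).primeFactorsList.length := by
        rw [← hK, Subgroup.orderOf_coe]
        exact Subgroup.orderOf_dvd_natCard K hu
      have := hp.out.dvd_of_dvd_pow (hd.trans h1)
      exact hrp ((Nat.prime_dvd_prime_iff_eq hp.out hr).1 this).symm

/-- Here s counts the nonidentity p'-elements of C(x), a = |C(x)|, and b, q are the p-parts of a and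
|G|. The upper bound gives n₁(s + 1) < 2b; if s ≥ 2 then 3n₁ < 2q, contradicting pn₁ ≥ (p - 1)q for
p ≥ 3. -/
theorem eq_one_of_class_bounds {p q b n₁ n₂ s : ℕ} (hp3 : 3 ≤ p) (hb : b ≤ q)
    (hs : 0 < s) (hn₂ : n₁ * s ≤ n₂) {a : ℕ} (ha : a ≤ b * (s + 1))
    (hc : (n₁ + n₂) ^ 2 < 2 * (n₁ * a)) (hl : p * q ≤ p * n₁ + q) : s = 1 ∧ n₁ < b := by
  have h1 : n₁ * (s + 1) * (n₁ * (s + 1)) < n₁ * (s + 1) * (2 * b) := by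
    calc n₁ * (s + 1) * (n₁ * (s + 1)) = (n₁ + n₁ * s) ^ 2 := by ring
      _ ≤ (n₁ + n₂) ^ 2 := by gcongr
      _ < 2 * (n₁ * a) := hc
      _ ≤ 2 * (n₁ * (b * (s + 1))) := by gcongr
      _ = _ := by ring
  have h2 : n₁ * (s + 1) < 2 * b := Nat.lt_of_mul_lt_mul_left h1
  have hs1 : s = 1 := by
    by_contra hne
    have h3 : n₁ * 3 ≤ n₁ * (s + 1) := Nat.mul_le_mul_left _ (by omega)
    have h4 : p * (n₁ * 3) ≤ p * (2 * q) := Nat.mul_le_mul_left _ (by omega)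
    have h5 : p * (n₁ * 3) < p * (2 * q) := Nat.mul_lt_mul_of_pos_left (by omega) (by omega)
    have h6 : q * p < q * 3 := by linarith
    exact absurd (Nat.lt_of_mul_lt_mul_left h6) (by omega)
  subst hs1
  exact ⟨rfl, by omega⟩

/-- The structure of `G` when the non-`p`-th powers are a class of `p`-elements and a class of
elements that are not `p`-elements. -/
theorem centralizer_structure (hp3 : 3 ≤ p) (hdvd : p ∣ Nat.card G) {x y : G}
    (hxp : IsPElement p x) (hyp : ¬ IsPElement p y)
    (hN : nonPowers G p = {z | IsConj x z} ∪ {z | IsConj y z})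
    (hcard : (nonPowers G p).ncard ^ 2 < 2 * Nat.card G) :
    ∃ u : G, regularCentralizer p x = {u} ∧ IsConj y (x * u) ∧ orderOf u = 2 ∧
      Nat.card (Subgroup.centralizer {x}) = 2 * ordProj[p] (Nat.card G) ∧
      {z | IsConj x z}.ncard < ordProj[p] (Nat.card G) ∧
      (nonPowers G p).ncard = 2 * {z | IsConj x z}.ncard := by
  have hxN : x ∈ nonPowers G p := by rw [hN]; exact Or.inl (IsConj.refl x)
  have hyN : y ∈ nonPowers G p := by rw [hN]; exact Or.inr (IsConj.refl y)
  have hxset : {g : G | IsPElement p g ∧ g ∈ nonPowers G p} = {z | IsConj x z} := by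
    ext z
    refine ⟨fun hz => ?_, fun hz => ⟨hxp.isConj hz, conj_mem_nonPowers hz hxN⟩⟩
    have h := hz.2
    rw [hN] at h
    exact h.resolve_right fun h' => hyp (hz.1.isConj h'.symm)
  have hyset : {g : G | ¬ IsPElement p g ∧ g ∈ nonPowers G p} = {z | IsConj y z} := by
    ext z
    refine ⟨fun hz => ?_, fun hz => ⟨fun h => hyp (h.isConj hz.symm), conj_mem_nonPowers hz hyN⟩⟩
    have h := hz.2
    rw [hN] at h
    exact h.resolve_left fun h' => hz.1 (hxp.isConj h')
  have hdisj : Disjoint {z | IsConj x z} {z | IsConj y z} :=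
    Set.disjoint_left.2 fun z hz hz' => hyp ((hxp.isConj hz).isConj hz'.symm)
  have hsum : (nonPowers G p).ncard = {z | IsConj x z}.ncard + {z | IsConj y z}.ncard := by
    rw [hN, Set.ncard_union_eq hdisj]
  have h1 := ncard_conj_mul_card_centralizer x
  have hl₁ := ordProj_mul_le_of_isPElement (G := G) hdvd
  have hl₂ := ordProj_mul_le_of_not_isPElement hyN hyp
  rw [hxset] at hl₁
  rw [hyset] at hl₂
  have hq : 0 < ordProj[p] (Nat.card G) := pow_pos hp.out.pos _
  -- Otherwise |C(x)| is a power of p, at most q. With class sizes m and k, 4mk ≤ (m + k)² <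
  -- 2m|C(x)| gives 2k < q, against the lower bound for k.
  obtain ⟨u₀, hu₀⟩ : (regularCentralizer p x).Nonempty := by
    by_contra hne
    rw [Set.not_nonempty_iff_eq_empty] at hne
    obtain ⟨i, hi, hi'⟩ := exists_card_centralizer_eq_pow (p := p) (x := x) fun u hu hu' => by
      by_contra hu1
      exact (hne ▸ (⟨hu, hu', hu1⟩ : u ∈ regularCentralizer p x) : u ∈ (∅ : Set G))
    have hle : p ^ i ≤ ordProj[p] (Nat.card G) := Nat.pow_le_pow_right hp.out.pos hi
    rw [hsum, ← h1, hi'] at hcard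
    generalize ordProj[p] (Nat.card G) = q at *
    generalize p ^ i = a at *
    generalize {z | IsConj x z}.ncard = m at *
    generalize {z | IsConj y z}.ncard = k at *
    have h2 : m * (2 * k) < m * a := by
      zify at hcard ⊢
      nlinarith [sq_nonneg ((m : ℤ) - k)]
    have h3 : 2 * k < q := (Nat.lt_of_mul_lt_mul_left h2).trans_le hle
    have h4 : p * (2 * k) ≤ p * q := Nat.mul_le_mul_left _ h3.le
    have h5 : q * p ≤ q * 2 := by linarith
    exact absurd (Nat.le_of_mul_le_mul_left h5 hq) (by omega)
  have hyu (u : G) (hu : u ∈ regularCentralizer p x) : IsConj y (x * u) := by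
    have : x * u ∈ {g : G | ¬ IsPElement p g ∧ g ∈ nonPowers G p} :=
      ⟨fun h => hu.2.2 ((mul_isPElement_iff hxp hu.2.1 hu.1).1 h),
        mul_mem_nonPowers hxN hxp hu.2.1 hu.1⟩
    rw [hyset] at this
    exact this
  obtain ⟨N, M, -, -, -, hM, hM'⟩ := exists_part_exponents G p
  -- x * u and x * v are both conjugate to y, hence so are their p'-parts u and v to each other.
  have horder (u v : G) (hu : u ∈ regularCentralizer p x) (hv : v ∈ regularCentralizer p x) :
      orderOf u = orderOf v := by
    have hN' (w : G) (hw : w ∈ regularCentralizer p x) : (x * w) ^ N = w := by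
      rw [hw.1.mul_pow, (hM x hxp).1, (hM' w hw.2.1).1, one_mul]
    rw [← hN' u hu, ← hN' v hv]
    obtain ⟨c, hc⟩ := isConj_iff.1 ((hyu u hu).symm.trans (hyu v hv))
    refine orderOf_eq_of_isConj (isConj_iff.2 ⟨c, ?_⟩)
    rw [← conj_pow, hc]
  -- Some power of u₀ has prime order r, so the common order is r.
  obtain ⟨r, hr, hru⟩ := Nat.exists_prime_and_dvd (n := orderOf u₀)
    (fun h => hu₀.2.2 (orderOf_eq_one_iff.1 h))
  have hrp : r ≠ p := by rintro rfl; exact hu₀.2.1 hru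
  have hu₁r : orderOf (u₀ ^ (orderOf u₀ / r)) = r :=
    orderOf_pow_orderOf_div (orderOf_pos u₀).ne' hru
  have hu₁ : u₀ ^ (orderOf u₀ / r) ∈ regularCentralizer p x := by
    refine ⟨hu₀.1.pow_right _, ?_, ?_⟩
    · rw [hu₁r, Nat.prime_dvd_prime_iff_eq hp.out hr]
      exact hrp.symm
    · intro h
      rw [h, orderOf_one] at hu₁r
      exact hr.one_lt.ne hu₁r
  have hallr (u : G) (hu : u ∈ regularCentralizer p x) : orderOf u = r :=
    (horder u _ hu hu₁).trans hu₁r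
  obtain ⟨i, hi, j, hij, hj⟩ := card_centralizer_le hr hrp hallr
  have hn₂ := ncard_mul_regularCentralizer_le hxN hxp
  rw [hyset] at hn₂
  have hb : p ^ i ≤ ordProj[p] (Nat.card G) := Nat.pow_le_pow_right hp.out.pos hi
  obtain ⟨hs, hlt⟩ := eq_one_of_class_bounds hp3 hb
    ((Set.ncard_pos (Set.toFinite _)).2 ⟨u₀, hu₀⟩) hn₂ (hij ▸ Nat.mul_le_mul_left _ hj)
    (by rw [← hsum, h1]; exact hcard) hl₁
  obtain ⟨u, hu⟩ := Set.ncard_eq_one.1 hs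
  have humem : u ∈ regularCentralizer p x := by rw [hu]; rfl
  have huinv : u⁻¹ = u := by
    have : u⁻¹ ∈ regularCentralizer p x :=
      ⟨humem.1.inv_right, by rw [orderOf_inv]; exact humem.2.1, inv_ne_one.2 humem.2.2⟩
    rw [hu] at this
    exact this
  have hu2 : orderOf u = 2 :=
    orderOf_eq_prime (by rw [sq]; nth_rw 1 [← huinv]; exact inv_mul_cancel u) humem.2.2
  have hr2 : r = 2 := (hallr u humem).symm.trans hu2
  have him : i = (Nat.card G).factorization p := by
    by_contra hne
    have : p * p ^ i ≤ ordProj[p] (Nat.card G) := by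
      rw [← pow_succ']
      exact Nat.pow_le_pow_right hp.out.pos (by omega)
    generalize ordProj[p] (Nat.card G) = q at *
    generalize p ^ i = b at *
    nlinarith
  have hj1 : r ^ j = 2 := by
    have hj0 : j ≠ 0 := by
      rintro rfl
      have hud : orderOf u ∣ Nat.card (Subgroup.centralizer {x}) :=
        Subgroup.orderOf_dvd_natCard _ (Subgroup.mem_centralizer_singleton_iff.2 humem.1.symm)
      rw [hij, pow_zero, mul_one, ← hr2.trans hu2.symm] at hud
      exact hrp ((Nat.prime_dvd_prime_iff_eq hr hp.out).1 (hr.dvd_of_dvd_pow hud))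
    rw [hs] at hj
    have : r ≤ r ^ j := Nat.le_self_pow hj0 r
    omega
  -- x is a power of x * u, and conjugation by C(x) fixes u, its only nonidentity p'-element.
  have hcent : Subgroup.centralizer {x * u} = Subgroup.centralizer {x} := by
    ext g
    rw [Subgroup.mem_centralizer_singleton_iff, Subgroup.mem_centralizer_singleton_iff]
    constructor
    · intro hg
      have hg' : Commute g (x * u) := hg
      have := hg'.pow_right M
      rw [humem.1.mul_pow, (hM x hxp).2, (hM' u humem.2.1).2, mul_one] at this
      exact this
    · intro hg
      have hgx : g * x * g⁻¹ = x := mul_inv_eq_iff_eq_mul.2 hg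
      have := conj_mem_regularCentralizer g humem
      rw [hgx, hu] at this
      have hgu : Commute g u := mul_inv_eq_iff_eq_mul.1 this
      exact Commute.mul_right (show Commute g x from hg) hgu
  have hyx : {z | IsConj y z}.ncard = {z | IsConj x z}.ncard := by
    have h2 := ncard_conj_mul_card_centralizer y
    rw [card_centralizer_eq_of_isConj (hyu u humem), hcent] at h2
    exact Nat.eq_of_mul_eq_mul_right Nat.card_pos (h2.trans h1.symm)
  refine ⟨u, hu, hyu u humem, hu2, ?_, him ▸ hlt, by rw [hsum, hyx, two_mul]⟩
  rw [hij, hj1, him, mul_comm]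

end Mixed

/-! ### The central involution and the Frobenius quotient. -/

section Extension

theorem eq_one_of_isPElement_of_mem_zpowers {G : Type*} [Group G] [Finite G] {p : ℕ}
    [hp : Fact p.Prime] {u g : G} (hu : ¬ p ∣ orderOf u) (hg : IsPElement p g)
    (hgu : g ∈ Subgroup.zpowers u) : g = 1 := by
  obtain ⟨N, M, -, -, -, h4, h5⟩ := exists_part_exponents G p
  have : ¬ p ∣ orderOf g := fun h => hu (h.trans (orderOf_dvd_of_mem_zpowers hgu))
  rw [← (h5 g this).1, (h4 g hg).1]

theorem centralExtension_of_mixed {G : Type u} [Group G] [Finite G] {p : ℕ} [hp : Fact p.Prime]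
    (hp3 : 3 ≤ p) (hdvd : p ∣ Nat.card G) {x y : G}
    (hxp : IsPElement p x) (hyp : ¬ IsPElement p y)
    (hN : nonPowers G p = {z | IsConj x z} ∪ {z | IsConj y z})
    (hcard : (nonPowers G p).ncard ^ 2 < 2 * Nat.card G) :
    orderOf x = p ∧ orderOf y = 2 * p ∧ ∃ k, (nonPowers G p).ncard = 2 * k ∧
      Nat.card G = 2 * (k * (k + 1)) ∧ ∃ (F : Type u) (_ : Group F), IsFrobeniusGroup F ∧
        Nat.card F = k * (k + 1) ∧ IsCentralExtension G F := by
  obtain ⟨u, hu, hyu, hu2, hC, hlt, hn⟩ := centralizer_structure hp3 hdvd hxp hyp hN hcard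
  have humem : u ∈ regularCentralizer p x := by rw [hu]; rfl
  have hxN : x ∈ nonPowers G p := by rw [hN]; exact Or.inl (IsConj.refl x)
  have hx1 : x ≠ 1 := by
    rintro rfl
    exact mem_nonPowers.1 hxN 1 (one_pow p)
  have hxset : {g : G | IsPElement p g ∧ g ∈ nonPowers G p} = {z | IsConj x z} := by
    ext z
    refine ⟨fun hz => ?_, fun hz => ⟨hxp.isConj hz, conj_mem_nonPowers hz hxN⟩⟩
    have h := hz.2
    rw [hN] at h
    exact h.resolve_right fun h' => hyp (hz.1.isConj h'.symm)
  have h1 := ncard_conj_mul_card_centralizer x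
  rw [hC] at h1
  obtain ⟨P, hnorm, hPcard, hmem, hcomm, hnon, hexp, hk⟩ :=
    exists_normal_elementary_sylow hp3 hdvd (by rw [hxset]; exact hlt)
      (by rw [hxset]; exact not_dvd_of_mul_ordProj_eq h1) (by
        intro g hg hgN
        have : g ∈ {z | IsConj x z} := hxset ▸ (⟨hg, hgN⟩ : _ ∧ _)
        rw [← card_centralizer_eq_of_isConj this, hC]
        exact dvd_mul_left _ 2)
  rw [hxset] at hk
  have hxP : x ∈ P := (hmem x).2 hxp
  have hxo : orderOf x = p := orderOf_eq_prime (hexp x hxP) hx1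
  have hyo : orderOf y = 2 * p := by
    rw [orderOf_eq_of_isConj hyu, humem.1.orderOf_mul_eq_mul_orderOf_of_coprime, hxo, hu2, mul_comm]
    rw [hxo]
    exact (Nat.Prime.coprime_iff_not_dvd hp.out).2 humem.2.1
  have huC (g : G) (hg : Commute g x) : Commute g u := by
    have hgx : g * x * g⁻¹ = x := mul_inv_eq_iff_eq_mul.2 hg
    have := conj_mem_regularCentralizer g humem
    rw [hgx, hu] at this
    exact mul_inv_eq_iff_eq_mul.1 this
  -- As P is abelian, g⁻¹ * x * g centralizes x and hence u. Conjugating back, g * u * g⁻¹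
  -- centralizes x, so it equals u.
  have hucenter : u ∈ Subgroup.center G := by
    rw [Subgroup.mem_center_iff]
    intro g
    have hgP : g⁻¹ * x * g ∈ P := by simpa using hnorm.conj_mem x hxP g⁻¹
    have h2 := (Commute.conj_iff g).2 (huC _ (hcomm _ hgP x hxP))
    have h3 : g * u * g⁻¹ ∈ regularCentralizer p x := by
      have e : g * (g⁻¹ * x * g) * g⁻¹ = x := by group
      rw [e] at h2
      refine ⟨h2, ?_, fun h => humem.2.2 (conj_eq_one_iff.1 h)⟩
      have : orderOf (g * u * g⁻¹) = orderOf u := MulEquiv.orderOf_eq (MulAut.conj g) u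
      rw [this]
      exact humem.2.1
    rw [hu] at h3
    exact mul_inv_eq_iff_eq_mul.1 h3
  have hZle : Subgroup.zpowers u ≤ Subgroup.center G := by rwa [Subgroup.zpowers_le]
  have hZnorm : (Subgroup.zpowers u).Normal := ⟨fun a ha g => by
    rwa [Subgroup.mem_center_iff.1 (hZle ha) g, mul_inv_cancel_right]⟩
  have hcardF : Nat.card (G ⧸ Subgroup.zpowers u) =
      {z | IsConj x z}.ncard * ({z | IsConj x z}.ncard + 1) := by
    have := Subgroup.card_eq_card_quotient_mul_card_subgroup (Subgroup.zpowers u)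
    rw [Nat.card_zpowers, hu2, ← h1, ← hk] at this
    nlinarith
  refine ⟨hxo, hyo, _, hn, by rw [← h1, ← hk]; ring, G ⧸ Subgroup.zpowers u, inferInstance, ?_,
    hcardF, QuotientGroup.mk' _, QuotientGroup.mk'_surjective _, by
      rw [QuotientGroup.ker_mk']; exact hZle⟩
  set f := QuotientGroup.mk' (Subgroup.zpowers u) with hf
  have hfs : Function.Surjective f := QuotientGroup.mk'_surjective _
  have hf1 (g : G) : f g = 1 ↔ g ∈ Subgroup.zpowers u := QuotientGroup.eq_one_iff g
  have hKnorm : (P.map f).Normal := hnorm.map f hfs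
  have hp2 : p ≤ ordProj[p] (Nat.card G) :=
    Nat.le_of_dvd (pow_pos hp.out.pos _)
      (dvd_pow_self p (hp.out.factorization_pos_of_dvd Nat.card_pos.ne' hdvd).ne')
  obtain ⟨N, M, hNM, hNp, hMp, -, -⟩ := exists_part_exponents G p
  refine isFrobeniusGroup_of_centralizer_le (P.map f) ?_ ?_ ?_ ?_
  · intro h
    have hx : f x ∈ P.map f := Subgroup.mem_map_of_mem f hxP
    rw [h, Subgroup.mem_bot, hf1] at hx
    exact hx1 (eq_one_of_isPElement_of_mem_zpowers humem.2.1 hxp hx)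
  · intro h
    have hdv := P.card_map_dvd f
    rw [h, Subgroup.card_top, hcardF, hPcard, ← hk] at hdv
    have := Nat.le_of_dvd (by omega) hdv
    nlinarith
  · refine Nat.Coprime.of_dvd (P.card_map_dvd f) (Subgroup.index_map_dvd P hfs) ?_
    rw [hPcard]
    refine Nat.Coprime.pow_left _ ((Nat.Prime.coprime_iff_not_dvd hp.out).2 ?_)
    have := P.index_mul_card
    rw [hPcard] at this
    exact not_dvd_of_mul_ordProj_eq (G := G) (c := 1) (by rw [one_mul]; exact this)
  · rintro _ ⟨h, hh, rfl⟩ hh1 gbar hg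
    obtain ⟨g, rfl⟩ := hfs gbar
    have hne : h ≠ 1 := by rintro rfl; exact hh1 (map_one f)
    -- The commutator lies in P and in the kernel ⟨u⟩, which intersect trivially.
    have hgh : Commute g h := by
      have hz : f (g * h * g⁻¹ * h⁻¹) = 1 := by
        rw [map_mul, map_mul, map_mul, map_inv, map_inv, hg.eq]
        group
      have hP : g * h * g⁻¹ * h⁻¹ ∈ P := P.mul_mem (hnorm.conj_mem h hh g) (P.inv_mem hh)
      have := eq_one_of_isPElement_of_mem_zpowers humem.2.1 ((hmem _).1 hP) ((hf1 _).1 hz)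
      exact mul_inv_eq_iff_eq_mul.1 (mul_inv_eq_one.1 this)
    have hhx : h ∈ {z | IsConj x z} := hxset ▸ (⟨(hmem h).1 hh, hnon h hh hne⟩ : _ ∧ _)
    obtain ⟨c, hc⟩ := isConj_iff.1 hhx
    -- h is conjugate to x and u is central, so u is also the only nonidentity p'-element of C(h).
    -- Modulo ⟨u⟩ only the p-part of g remains, and it lies in P.
    have hgN : f (g ^ N) = 1 := by
      rw [hf1]
      by_cases hgN1 : g ^ N = 1
      · rw [hgN1]; exact one_mem _
      · have hreg : g ^ N ∈ regularCentralizer p h :=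
          ⟨(hgh.pow_left N).symm, hNp g, hgN1⟩
        have h3 := conj_mem_regularCentralizer c⁻¹ hreg
        have e : c⁻¹ * h * c⁻¹⁻¹ = x := by rw [← hc]; group
        rw [e, hu] at h3
        have h4 : c⁻¹ * g ^ N * c⁻¹⁻¹ = u := h3
        have h5 : g ^ N = u := by
          have h6 : g ^ N = c * u * c⁻¹ := by rw [← h4]; group
          rw [h6, Subgroup.mem_center_iff.1 hucenter c, mul_inv_cancel_right]
        rw [h5]
        exact Subgroup.mem_zpowers u
    have : f g = f (g ^ M) := by
      conv_lhs => rw [← hNM g]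
      rw [map_mul, hgN, one_mul]
    rw [this]
    exact Subgroup.mem_map_of_mem f ((hmem _).2 (hMp g))

end Extension

end NonPowers

/-! ### The classification. -/

theorem mainTheorem3 (G : Type u) [Group G] [Finite G] (p n : ℕ) (hp : p.Prime)
    (hodd : Odd p) (hdvd : p ∣ Nat.card G) (hn : n = NonPowers.numNonPowers G p)
    (hlen : NonPowers.length G p = 2) (hcard : (n : ℚ) ^ 2 / 2 < (Nat.card G : ℚ)) :
    (NonPowers.type G p = [p, p] ∧
      (Nat.card G : ℚ) = (n : ℚ) / 2 * ((n : ℚ) + 1) ∧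
      (Nat.card G ≠ 3 → NonPowers.IsFrobeniusGroup G)) ∨
    (NonPowers.type G p = [p, 2 * p] ∧
      (Nat.card G : ℚ) = (n : ℚ) / 2 * ((n : ℚ) + 2) ∧
      ∃ (F : Type u) (_ : Group F), NonPowers.IsFrobeniusGroup F ∧
        (Nat.card F : ℚ) = (n : ℚ) / 2 * ((n : ℚ) / 2 + 1) ∧
        NonPowers.IsCentralExtension G F) := by
  classical
  have := Fact.mk hp
  have hp3 : 3 ≤ p := by
    have := hp.two_le
    obtain ⟨k, rfl⟩ := hodd
    omega
  have hn' : (NonPowers.nonPowers G p).ncard = n := hn.symm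
  have hcard' : n ^ 2 < 2 * Nat.card G := by
    rw [div_lt_iff₀ (by norm_num)] at hcard
    have : ((n ^ 2 : ℕ) : ℚ) < ((2 * Nat.card G : ℕ) : ℚ) := by
      push_cast
      linarith
    exact_mod_cast this
  obtain ⟨x, y, hxy, hcl, hN⟩ := NonPowers.exists_isConj_of_length_eq_two hlen
  by_cases hall : ∀ z ∈ NonPowers.nonPowers G p, NonPowers.IsPElement p z
  · obtain ⟨hx, hy, hG, hF⟩ := NonPowers.frobenius_of_forall_isPElement hp3 hdvd hxy hN hall
      (hn'.symm ▸ hcard')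
    refine Or.inl ⟨?_, ?_, hF⟩
    · rw [NonPowers.type_eq_of_classes hxy hcl (by rw [hx, hy]), hx, hy]
    · rw [hn'] at hG
      have : ((2 * Nat.card G : ℕ) : ℚ) = ((n * (n + 1) : ℕ) : ℚ) := by rw [hG]
      push_cast at this
      linarith
  · right
    wlog hyp : ¬ NonPowers.IsPElement p y generalizing x y
    · refine this y x (fun h => hxy h.symm) (by rw [hcl, Set.pair_comm])
        (by rw [hN, Set.union_comm]) fun hxp => hall fun z hz => ?_
      rw [hN] at hz
      exact hz.elim (fun h => hxp.isConj h) fun h => (not_not.1 hyp).isConj h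
    -- Root counting provides a non-power p-element; it cannot lie in the class of y.
    have hxp : NonPowers.IsPElement p x := by
      obtain ⟨g, hg, hgN⟩ := NonPowers.exists_isPElement_mem_nonPowers (G := G) hdvd
      rw [hN] at hgN
      exact hgN.elim (fun h => hg.isConj h.symm) fun h => absurd (hg.isConj h.symm) hyp
    obtain ⟨hx, hy, k, hk, hG, F, hFg, hF, hFc, hext⟩ :=
      NonPowers.centralExtension_of_mixed hp3 hdvd hxp hyp hN (hn'.symm ▸ hcard')
    have hnk : (n : ℚ) = 2 * k := by rw [← hn', hk]; push_cast; ring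
    refine ⟨?_, ?_, F, hFg, hF, ?_, hext⟩
    · rw [NonPowers.type_eq_of_classes hxy hcl (by rw [hx, hy]; omega), hx, hy]
    · rw [hG, hnk]
      push_cast
      ring
    · rw [hFc, hnk]
      push_cast
      ring
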